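/- Let $n,m\ge 0$ and let $f:\mathbb{R}^n\to[0,1]$ and $g:\mathbb{R}^m\to[0,1]$ be $C^2$ functions. Let $U=(u_{i,j})_{i,j\in\{0,1\}}$ be a real $2\times 2$ matrix and consider the hidden bilinear zero-sum game with payoff $$r(\theta,\phi)=F(\theta)^\top U\,G(\phi),\qquad F(\theta)=\binom{f(\theta)}{1-f(\theta)},\quad G(\phi)=\binom{g(\phi)}{1-g(\phi)} .$$ Assume that the $2\times 2$ game has a unique fully mixed Nash equilibrium, i.e. $$v=u_{0,0}-u_{0,1}-u_{1,0}+u_{1,1}\neq 0,\qquad p=-\frac{u_{1,0}-u_{1,1}}{v}\in(0,1),\qquad q=-\frac{u_{0,1}-u_{1,1}}{v}\in(0,1),$$ and put $P=\binom{p}{1-p}$, $Q=\binom{q}{1-q}$. Let $(\theta(t),\phi(t))$, $t\ge 0$, be a solution of the gradient-descent-ascent system $$\dot\theta=-v\,\nabla f(\theta)\,(g(\phi)-q),\qquad \dot\phi=v\,\nabla g(\phi)\,(f(\theta)-p).$$ For $\theta_0\in\mathbb{R}^n$ let $f_{\theta_0}$ be the set of all values $f(x(t))$, $t\in\mathbb{R}$,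 where $x$ is the solution of the gradient ascent dynamics $\dot x=\nabla f(x)$, $x(0)=\theta_0$; define $g_{\phi_0}$ for $\phi_0\in\mathbb{R}^m$ in the same way. Suppose that the initial conditions are safe: $\nabla f(\theta(0))\neq 0$, $\nabla g(\phi(0))\neq 0$, $p\in f_{\theta(0)}$ and $q\in g_{\phi(0)}$. Then $$\lim_{T\to\infty}\frac1T\int_0^T f(\theta(t))\,dt=p,\qquad \lim_{T\to\infty}\frac1T\int_0^T r(\theta(t),\phi(t))\,dt=P^\top U Q,\qquad \lim_{T\to\infty}\frac1T\int_0^T g(\phi(t))\,dt=q .$$ -/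

import Mathlib

open Filter Topology Set

namespace HiddenGame

noncomputable section

/-- The mixed strategy of a player with two strategies who plays the first one with probability
`a`, i.e. the column vector `(a, 1 - a)`. -/
def mixed (a : ℝ) : Fin 2 → ℝ := ![a, 1 - a]

/-- The bilinear payoff `xᵀ U y`. -/
def bilinearPayoff (U : Matrix (Fin 2) (Fin 2) ℝ) (x y : Fin 2 → ℝ) : ℝ :=
  x ⬝ᵥ (U.mulVec y)

/-- The payoff `r(θ, φ) = F(θ)ᵀ U G(φ)` of the hidden game, with `F = (f, 1 - f)` and
`G = (g, 1 - g)`. -/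
def payoff {n m : ℕ} (U : Matrix (Fin 2) (Fin 2) ℝ)
    (f : EuclideanSpace ℝ (Fin n) → ℝ) (g : EuclideanSpace ℝ (Fin m) → ℝ)
    (θ : EuclideanSpace ℝ (Fin n)) (φ : EuclideanSpace ℝ (Fin m)) : ℝ :=
  bilinearPayoff U (mixed (f θ)) (mixed (g φ))

/-- `v = u₀₀ - u₀₁ - u₁₀ + u₁₁`. -/
def nashV (U : Matrix (Fin 2) (Fin 2) ℝ) : ℝ := U 0 0 - U 0 1 - U 1 0 + U 1 1

/-- `p = -(u₁₀ - u₁₁) / v`. -/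
def nashP (U : Matrix (Fin 2) (Fin 2) ℝ) : ℝ := -(U 1 0 - U 1 1) / nashV U

/-- `q = -(u₀₁ - u₁₁) / v`. -/
def nashQ (U : Matrix (Fin 2) (Fin 2) ℝ) : ℝ := -(U 0 1 - U 1 1) / nashV U

/-- The hidden `2 × 2` game has a unique, fully mixed Nash equilibrium:
`v ≠ 0` and `p, q ∈ (0, 1)`. -/
def HasInteriorNash (U : Matrix (Fin 2) (Fin 2) ℝ) : Prop :=
  nashV U ≠ 0 ∧ nashP U ∈ Ioo (0 : ℝ) 1 ∧ nashQ U ∈ Ioo (0 : ℝ) 1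

/-- `x : ℝ → ℝᵈ` is the solution of the gradient ascent dynamics `ẋ = ∇k(x)`, `x(0) = x₀`,
over all (positive and negative) times. -/
def IsGradientAscent {d : ℕ} (k : EuclideanSpace ℝ (Fin d) → ℝ)
    (x₀ : EuclideanSpace ℝ (Fin d)) (x : ℝ → EuclideanSpace ℝ (Fin d)) : Prop :=
  x 0 = x₀ ∧ ∀ t : ℝ, HasDerivAt x (gradient k (x t)) t

/-- The set `k_{x₀}` of the values that `k(x(t))` attains under the gradient ascent dynamics
started at `x₀`. -/
def attainable {d : ℕ} (k : EuclideanSpace ℝ (Fin d) → ℝ)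
    (x₀ : EuclideanSpace ℝ (Fin d)) : Set ℝ :=
  {y | ∃ x : ℝ → EuclideanSpace ℝ (Fin d), IsGradientAscent k x₀ x ∧ ∃ t : ℝ, k (x t) = y}

/-- Safe initial conditions: `θ₀` and `φ₀` are not stationary points of `f` and `g`, and the
equilibrium probabilities are attainable, `p ∈ f_{θ₀}` and `q ∈ g_{φ₀}`. -/
def IsSafe {n m : ℕ} (U : Matrix (Fin 2) (Fin 2) ℝ)
    (f : EuclideanSpace ℝ (Fin n) → ℝ) (g : EuclideanSpace ℝ (Fin m) → ℝ)
    (θ₀ : EuclideanSpace ℝ (Fin n)) (φ₀ : EuclideanSpace ℝ (Fin m)) : Prop :=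
  gradient f θ₀ ≠ 0 ∧ gradient g φ₀ ≠ 0 ∧
    nashP U ∈ attainable f θ₀ ∧ nashQ U ∈ attainable g φ₀

/-- `(θ, φ)` solves the gradient-descent-ascent equations
`θ̇ = -v ∇f(θ) (g(φ) - q)`, `φ̇ = v ∇g(φ) (f(θ) - p)` for all times `t ≥ 0`
(with the one-sided derivative at `t = 0`). -/
def IsGDASolution {n m : ℕ} (U : Matrix (Fin 2) (Fin 2) ℝ)
    (f : EuclideanSpace ℝ (Fin n) → ℝ) (g : EuclideanSpace ℝ (Fin m) → ℝ)
    (θ : ℝ → EuclideanSpace ℝ (Fin n)) (φ : ℝ → EuclideanSpace ℝ (Fin m)) : Prop :=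
  ∀ t : ℝ, 0 ≤ t →
    HasDerivWithinAt θ ((-nashV U * (g (φ t) - nashQ U)) • gradient f (θ t)) (Ici 0) t ∧
    HasDerivWithinAt φ ((nashV U * (f (θ t) - nashP U)) • gradient g (φ t)) (Ici 0) t

end

end HiddenGame

/-!
Along the gradient-descent-ascent flow each player only moves along one orbit of gradient ascent:
if `x` and `y` are the gradient ascent orbits of `f` and `g` through `θ 0` and `φ 0`, then
`θ t = x (τ t)` and `φ t = y (σ t)`, where the clocks `τ` and `σ` run at the (signed) speeds
`-v (g (φ t) - q)` and `v (f (θ t) - p)`. This is uniqueness for ordinary differential equations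
(`exists_clock`). With `F = f ∘ x` and `G = g ∘ y` the dynamics becomes the planar system
`τ' = -v (G σ - q)`, `σ' = v (F τ - p)`.

Since the orbits are not stationary, `F` and `G` are strictly increasing
(`IsGradientAscent.strictMono`), and by safety they attain the values `p` and `q`. Hence the
primitives `A` of `F - p` and `B` of `G - q` are convex and coercive (`exists_coercive_primitive`).
The function `A τ + B σ` is a constant of motion, so the clocks `τ` and `σ` stay bounded
(`planar_bounded`).

The averages now follow without any analysis of the periodic orbits: `f (θ t) - p`, `g (φ t) - q`
and the payoff minus its equilibrium value `v (f (θ t) - p) (g (φ t) - q)` are the time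
derivatives of the bounded functions `σ / v`, `-τ / v` and `-A ∘ τ`, and a quantity whose
difference from a constant has a bounded primitive averages to that constant
(`tendsto_average_of_bounded_primitive`).
-/

namespace HiddenGame

/-! ### Primitives and time averages on the half-line -/

lemma continuousOn_Ici_of_hasDerivWithinAt {E : Type*} [NormedAddCommGroup E] [NormedSpace ℝ E]
    {x x' : ℝ → E} (hx : ∀ t, 0 ≤ t → HasDerivWithinAt x (x' t) (Ici 0) t) :
    ContinuousOn x (Ici 0) :=
  fun t ht => (hx t ht).continuousWithinAt

lemma exists_primitive_Ici {c : ℝ → ℝ} (hc : ContinuousOn c (Ici 0)) :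
    ∃ τ : ℝ → ℝ, τ 0 = 0 ∧ ∀ t, 0 ≤ t → HasDerivWithinAt τ (c t) (Ici 0) t := by
  -- Extend `c` to a continuous function on the line, constant on `(-∞, 0]`.
  have hcont : Continuous fun t => c (max t 0) :=
    hc.comp_continuous (by fun_prop) fun t => le_max_right t 0
  refine ⟨fun t => ∫ u in (0 : ℝ)..t, c (max u 0), by simp, fun t ht => ?_⟩
  have h := (hcont.integral_hasStrictDerivAt 0 t).hasDerivAt.hasDerivWithinAt (s := Ici 0)
  simpa only [max_eq_left ht] using h

lemma tendsto_average_of_bounded_primitive {h b : ℝ → ℝ} {L C : ℝ}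
    (hh : ContinuousOn h (Ici 0))
    (hb : ∀ t, 0 ≤ t → HasDerivWithinAt b (h t - L) (Ici 0) t)
    (hC : ∀ t, 0 ≤ t → |b t| ≤ C) :
    Tendsto (fun T : ℝ => (∫ t in (0 : ℝ)..T, h t) / T) atTop (𝓝 L) := by
  have hint : ∀ T, 0 ≤ T → ∫ t in (0 : ℝ)..T, h t = (b T - b 0) + L * T := by
    intro T hT
    have hsub : Icc 0 T ⊆ Ici (0 : ℝ) := Icc_subset_Ici_self
    have key := intervalIntegral.integral_eq_sub_of_hasDeriv_right_of_le
      (f := fun t => b t + L * t) (f' := h) hT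
      (((continuousOn_Ici_of_hasDerivWithinAt hb).mono hsub).add (by fun_prop))
      (fun t ht => by
        have h1 := ((hb t ht.1.le).mono (Ioi_subset_Ici ht.1.le)).add
          ((hasDerivAt_id t).const_mul L).hasDerivWithinAt
        exact h1.congr_deriv (by ring))
      ((hh.mono hsub).intervalIntegrable_of_Icc hT)
    rw [key]
    ring
  have hlim : Tendsto (fun T : ℝ => (b T - b 0) / T) atTop (𝓝 0) := by
    refine squeeze_zero_norm' (a := fun T => (2 * C) / T) ?_
      (tendsto_const_nhds.div_atTop tendsto_id)
    filter_upwards [eventually_gt_atTop 0] with T hT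
    rw [Real.norm_eq_abs, abs_div, abs_of_pos hT]
    have h1 := hC T hT.le
    have h0 := hC 0 le_rfl
    have := abs_sub (b T) (b 0)
    gcongr
    linarith
  have hlim' := hlim.add_const L
  rw [zero_add] at hlim'
  refine hlim'.congr' ?_
  filter_upwards [eventually_gt_atTop 0] with T hT
  rw [hint T hT.le]
  field_simp

/-! ### Reparametrised orbits of an autonomous vector field -/

section VectorField

variable {E : Type*} [NormedAddCommGroup E] [NormedSpace ℝ E]

lemma eq_of_hasDerivWithinAt_smul {V : E → E} (hV : LocallyLipschitz V)
    {c : ℝ → ℝ} (hc : ContinuousOn c (Ici 0)) {x y : ℝ → E}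
    (hx : ∀ t, 0 ≤ t → HasDerivWithinAt x (c t • V (x t)) (Ici 0) t)
    (hy : ∀ t, 0 ≤ t → HasDerivWithinAt y (c t • V (y t)) (Ici 0) t)
    (h0 : x 0 = y 0) {t : ℝ} (ht : 0 ≤ t) : x t = y t := by
  have hsub : Icc 0 t ⊆ Ici (0 : ℝ) := Icc_subset_Ici_self
  have hxc := (continuousOn_Ici_of_hasDerivWithinAt hx).mono hsub
  have hyc := (continuousOn_Ici_of_hasDerivWithinAt hy).mono hsub
  -- On the compact set swept out by both curves up to time `t` the field is Lipschitz.
  obtain ⟨K, hK⟩ := LocallyLipschitzOn.exists_lipschitzOnWith_of_compact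
    ((isCompact_Icc.image_of_continuousOn hxc).union (isCompact_Icc.image_of_continuousOn hyc))
    (hV.locallyLipschitzOn)
  obtain ⟨M, hM⟩ := isCompact_Icc.exists_bound_of_continuousOn (hc.mono hsub)
  refine ODE_solution_unique_of_mem_Icc_right (v := fun s z => c s • V z)
    (s := fun _ => x '' Icc 0 t ∪ y '' Icc 0 t) (K := M.toNNReal * K) ?_ hxc ?_ ?_ hyc ?_ ?_ h0
    ⟨ht, le_rfl⟩
  · intro s hs
    refine LipschitzOnWith.of_dist_le_mul fun z hz w hw => ?_
    have h1 : ‖c s‖ ≤ M.toNNReal :=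
      (hM s (Ico_subset_Icc_self hs)).trans (Real.le_coe_toNNReal M)
    have h2 := hK.dist_le_mul z hz w hw
    rw [dist_smul₀, NNReal.coe_mul, mul_assoc]
    gcongr
  · exact fun s hs => (hx s hs.1).mono (Ici_subset_Ici.2 hs.1)
  · exact fun s hs => Or.inl ⟨s, Ico_subset_Icc_self hs, rfl⟩
  · exact fun s hs => (hy s hs.1).mono (Ici_subset_Ici.2 hs.1)
  · exact fun s hs => Or.inr ⟨s, Ico_subset_Icc_self hs, rfl⟩

/-- A curve that follows the field `V` at the variable signed speed `c` is the integral curve of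
`V` through its initial point, run on the clock `τ` with `τ' = c`. -/
lemma exists_clock {V : E → E} (hV : LocallyLipschitz V)
    {c : ℝ → ℝ} (hc : ContinuousOn c (Ici 0)) {x z : ℝ → E}
    (hx : ∀ s, HasDerivAt x (V (x s)) s)
    (hz : ∀ t, 0 ≤ t → HasDerivWithinAt z (c t • V (z t)) (Ici 0) t)
    (h0 : x 0 = z 0) :
    ∃ τ : ℝ → ℝ, (∀ t, 0 ≤ t → HasDerivWithinAt τ (c t) (Ici 0) t) ∧
      ∀ t, 0 ≤ t → z t = x (τ t) := by
  obtain ⟨τ, hτ0, hτ⟩ := exists_primitive_Ici hc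
  refine ⟨τ, hτ, fun t ht => eq_of_hasDerivWithinAt_smul hV hc hz (y := fun t => x (τ t)) ?_ ?_ ht⟩
  · exact fun s hs => (hx (τ s)).scomp_hasDerivWithinAt s (hτ s hs)
  · rw [hτ0, h0]

/-- An integral curve cannot run into a zero of a locally Lipschitz field. -/
lemma ne_zero_of_integralCurve {V : E → E} (hV : LocallyLipschitz V) {x : ℝ → E}
    (hx : ∀ s, HasDerivAt x (V (x s)) s) (h0 : V (x 0) ≠ 0) (s : ℝ) : V (x s) ≠ 0 := by
  intro hs
  -- Travel from `x s` towards `x 0`, forwards if `s ≤ 0` and backwards if `0 ≤ s`; the constant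
  -- curve at the zero `x s` of `V` solves the same equation.
  have travel : ∀ e : ℝ, ∀ t, 0 ≤ t → x (s + e * t) = x s := by
    intro e t ht
    refine eq_of_hasDerivWithinAt_smul hV (c := fun _ => e) continuousOn_const
      (x := fun t => x (s + e * t)) (y := fun _ => x s) ?_ ?_ (by simp) ht
    · intro u _
      have h1 : HasDerivAt (fun u => s + e * u) e u := by
        simpa using ((hasDerivAt_id u).const_mul e).const_add s
      exact ((hx (s + e * u)).scomp u h1).hasDerivWithinAt
    · intro u _
      rw [hs, smul_zero]
      exact hasDerivWithinAt_const _ _ _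
  apply h0
  rcases le_total s 0 with h | h
  · rw [← hs, ← travel 1 (-s) (by linarith)]
    simp
  · rw [← hs, ← travel (-1) s h]
    simp

end VectorField

/-! ### Gradient ascent orbits -/

section GradientAscent

variable {d : ℕ} {k : EuclideanSpace ℝ (Fin d) → ℝ}

lemma locallyLipschitz_gradient (hk : ContDiff ℝ 2 k) : LocallyLipschitz (gradient k) := by
  have h : ContDiff ℝ 1 (fderiv ℝ k) := hk.fderiv_right (by norm_num)
  exact ((InnerProductSpace.toDual ℝ _).symm.contDiff.comp h).locallyLipschitz

lemma IsGradientAscent.hasDerivAt_comp (hk : ContDiff ℝ 2 k) {x₀ : EuclideanSpace ℝ (Fin d)}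
    {x : ℝ → EuclideanSpace ℝ (Fin d)} (hx : IsGradientAscent k x₀ x) (s : ℝ) :
    HasDerivAt (fun s => k (x s)) (‖gradient k (x s)‖ ^ 2) s := by
  have h1 := ((hk.differentiable (by norm_num)) (x s)).hasGradientAt.hasFDerivAt
  have h2 := h1.comp_hasDerivAt s (hx.2 s)
  exact h2.congr_deriv (by
    rw [InnerProductSpace.toDual_apply_apply, real_inner_self_eq_norm_sq])

lemma IsGradientAscent.strictMono (hk : ContDiff ℝ 2 k) {x₀ : EuclideanSpace ℝ (Fin d)}
    {x : ℝ → EuclideanSpace ℝ (Fin d)} (hx : IsGradientAscent k x₀ x)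
    (h0 : gradient k x₀ ≠ 0) : StrictMono fun s => k (x s) := by
  refine strictMono_of_deriv_pos fun s => ?_
  rw [(hx.hasDerivAt_comp hk s).deriv]
  have := ne_zero_of_integralCurve (locallyLipschitz_gradient hk) hx.2 (by rwa [hx.1]) s
  positivity

end GradientAscent

/-! ### The planar Hamiltonian system -/

/-- The primitive, based at `a`, of `F - F a` is coercive: it lies above its tangent lines at
`a - 1` and `a + 1`, which have negative and positive slope. -/
lemma exists_coercive_primitive {F : ℝ → ℝ} (hF : StrictMono F) (hc : Continuous F) (a : ℝ) :
    ∃ A : ℝ → ℝ, (∀ s, HasDerivAt A (F s - F a) s) ∧ (∀ s, 0 ≤ A s) ∧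
      ∀ C, ∃ R, ∀ s, A s ≤ C → |s| ≤ R := by
  set A : ℝ → ℝ := fun s => ∫ u in a..s, (F u - F a) with hA
  have hd : ∀ s, HasDerivAt A (F s - F a) s := fun s =>
    ((hc.sub continuous_const).integral_hasStrictDerivAt a s).hasDerivAt
  have hconv : ConvexOn ℝ univ A := by
    refine Monotone.convexOn_univ_of_deriv (fun s => (hd s).differentiableAt) ?_
    intro s t hst
    rw [(hd s).deriv, (hd t).deriv]
    linarith [hF.monotone hst]
  have tangent : ∀ b s, A b + (F b - F a) * (s - b) ≤ A s := by
    intro b s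
    rcases lt_trichotomy s b with h | rfl | h
    · have := hconv.slope_le_of_hasDerivAt (mem_univ s) (mem_univ b) h (hd b)
      rw [slope_def_field, div_le_iff₀ (by linarith)] at this
      linarith
    · simp
    · have := hconv.le_slope_of_hasDerivAt (mem_univ b) (mem_univ s) h (hd b)
      rw [slope_def_field, le_div_iff₀ (by linarith)] at this
      linarith
  have hnonneg : ∀ s, 0 ≤ A s := fun s => by simpa [hA] using tangent a s
  refine ⟨A, hd, hnonneg, fun C => ?_⟩
  have hr : 0 < F (a + 1) - F a := sub_pos.2 (hF (by linarith))
  have hl : 0 < F a - F (a - 1) := sub_pos.2 (hF (by linarith))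
  refine ⟨max (C / (F (a + 1) - F a) + (a + 1)) (C / (F a - F (a - 1)) - (a - 1)),
    fun s hs => abs_le'.2 ⟨le_max_of_le_left ?_, le_max_of_le_right ?_⟩⟩
  · have h1 := tangent (a + 1) s
    have h2 := hnonneg (a + 1)
    have : s - (a + 1) ≤ C / (F (a + 1) - F a) := by
      rw [le_div_iff₀ hr]
      linarith
    linarith
  · have h1 := tangent (a - 1) s
    have h2 := hnonneg (a - 1)
    have : a - 1 - s ≤ C / (F a - F (a - 1)) := by
      rw [le_div_iff₀ hl]
      linarith
    linarith

/-- A trajectory of the planar system `τ' = -v (G σ - q)`, `σ' = v (F τ - p)` stays bounded: it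
conserves `A τ + B σ`, where `A' = F - p` and `B' = G - q`. -/
lemma planar_bounded {F G A B τ σ : ℝ → ℝ} {v p q : ℝ}
    (hτ : ∀ t, 0 ≤ t → HasDerivWithinAt τ (-v * (G (σ t) - q)) (Ici 0) t)
    (hσ : ∀ t, 0 ≤ t → HasDerivWithinAt σ (v * (F (τ t) - p)) (Ici 0) t)
    (hA : ∀ s, HasDerivAt A (F s - p) s) (hB : ∀ s, HasDerivAt B (G s - q) s)
    (hA0 : ∀ s, 0 ≤ A s) (hB0 : ∀ s, 0 ≤ B s)
    (hAc : ∀ C, ∃ R, ∀ s, A s ≤ C → |s| ≤ R) (hBc : ∀ C, ∃ R, ∀ s, B s ≤ C → |s| ≤ R) :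
    ∃ C, ∀ t, 0 ≤ t → |τ t| ≤ C ∧ |σ t| ≤ C ∧ |A (τ t)| ≤ C := by
  have hH : ∀ t, 0 ≤ t → HasDerivWithinAt (fun t => A (τ t) + B (σ t)) 0 (Ici 0) t := by
    intro t ht
    have h1 := ((hA (τ t)).comp_hasDerivWithinAt t (hτ t ht)).add
      ((hB (σ t)).comp_hasDerivWithinAt t (hσ t ht))
    exact h1.congr_deriv (by ring)
  have hconst : ∀ t, 0 ≤ t → A (τ t) + B (σ t) = A (τ 0) + B (σ 0) := by
    intro t ht
    exact constant_of_has_deriv_right_zero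
      ((continuousOn_Ici_of_hasDerivWithinAt hH).mono Icc_subset_Ici_self)
      (fun s hs => (hH s hs.1).mono (Ici_subset_Ici.2 hs.1)) t ⟨ht, le_rfl⟩
  set h := A (τ 0) + B (σ 0)
  obtain ⟨R, hR⟩ := hAc h
  obtain ⟨S, hS⟩ := hBc h
  refine ⟨max R (max S h), fun t ht => ?_⟩
  have hAt := hA0 (τ t)
  have hBt := hB0 (σ t)
  have ht' := hconst t ht
  refine ⟨le_max_of_le_left (hR _ (by linarith)),
    le_max_of_le_right (le_max_of_le_left (hS _ (by linarith))),
    le_max_of_le_right (le_max_of_le_right ?_)⟩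
  rw [abs_of_nonneg hAt]
  linarith

/-! ### Average convergence -/

/-- The payoff has no linear terms when expanded at the equilibrium `(p, q)`, where both of its
partial derivatives vanish. -/
lemma bilinearPayoff_mixed (U : Matrix (Fin 2) (Fin 2) ℝ) (hv : nashV U ≠ 0) (a b : ℝ) :
    bilinearPayoff U (mixed a) (mixed b) =
      nashV U * (a - nashP U) * (b - nashQ U) +
        bilinearPayoff U (mixed (nashP U)) (mixed (nashQ U)) := by
  have hp : nashV U * nashP U = -(U 1 0 - U 1 1) := mul_div_cancel₀ _ hv
  have hq : nashV U * nashQ U = -(U 0 1 - U 1 1) := mul_div_cancel₀ _ hv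
  have expand : ∀ a b, bilinearPayoff U (mixed a) (mixed b) =
      nashV U * a * b + (U 0 1 - U 1 1) * a + (U 1 0 - U 1 1) * b + U 1 1 := by
    intro a b
    simp only [bilinearPayoff, mixed, nashV, dotProduct, Matrix.mulVec, Fin.sum_univ_two,
      Matrix.cons_val_zero, Matrix.cons_val_one]
    ring
  rw [expand, expand]
  linear_combination (b - nashQ U) * hp + (a - nashP U) * hq

end HiddenGame

theorem mainTheorem6 (n m : ℕ) (U : Matrix (Fin 2) (Fin 2) ℝ)
    (f : EuclideanSpace ℝ (Fin n) → ℝ) (g : EuclideanSpace ℝ (Fin m) → ℝ)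
    (hf : ContDiff ℝ 2 f) (hg : ContDiff ℝ 2 g)
    (hf01 : ∀ x, f x ∈ Set.Icc (0 : ℝ) 1) (hg01 : ∀ y, g y ∈ Set.Icc (0 : ℝ) 1)
    (hU : HiddenGame.HasInteriorNash U)
    (θ : ℝ → EuclideanSpace ℝ (Fin n)) (φ : ℝ → EuclideanSpace ℝ (Fin m))
    (hsol : HiddenGame.IsGDASolution U f g θ φ)
    (hsafe : HiddenGame.IsSafe U f g (θ 0) (φ 0)) :
    Tendsto (fun T : ℝ => (∫ t in (0 : ℝ)..T, f (θ t)) / T) atTop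
        (𝓝 (HiddenGame.nashP U)) ∧
      Tendsto (fun T : ℝ => (∫ t in (0 : ℝ)..T, HiddenGame.payoff U f g (θ t) (φ t)) / T) atTop
        (𝓝 (HiddenGame.bilinearPayoff U (HiddenGame.mixed (HiddenGame.nashP U))
          (HiddenGame.mixed (HiddenGame.nashQ U)))) ∧
      Tendsto (fun T : ℝ => (∫ t in (0 : ℝ)..T, g (φ t)) / T) atTop
        (𝓝 (HiddenGame.nashQ U)) := by
  open HiddenGame in
  obtain ⟨hv, -, -⟩ := hU
  obtain ⟨hf0, hg0, ⟨x, hx, a, ha⟩, ⟨y, hy, b, hb⟩⟩ := hsafe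
  have hfθ : ContinuousOn (fun t => f (θ t)) (Ici 0) :=
    hf.continuous.comp_continuousOn
      (continuousOn_Ici_of_hasDerivWithinAt fun t ht => (hsol t ht).1)
  have hgφ : ContinuousOn (fun t => g (φ t)) (Ici 0) :=
    hg.continuous.comp_continuousOn
      (continuousOn_Ici_of_hasDerivWithinAt fun t ht => (hsol t ht).2)
  obtain ⟨τ, hτ, hθτ⟩ := exists_clock (locallyLipschitz_gradient hf)
    (c := fun t => -nashV U * (g (φ t) - nashQ U))
    (continuousOn_const.mul (hgφ.sub continuousOn_const)) hx.2 (fun t ht => (hsol t ht).1) hx.1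
  obtain ⟨σ, hσ, hφσ⟩ := exists_clock (locallyLipschitz_gradient hg)
    (c := fun t => nashV U * (f (θ t) - nashP U))
    (continuousOn_const.mul (hfθ.sub continuousOn_const)) hy.2 (fun t ht => (hsol t ht).2) hy.1
  obtain ⟨A, hA, hA0, hAc⟩ := exists_coercive_primitive (hx.strictMono hf hf0)
    (continuous_iff_continuousAt.2 fun s => (hx.hasDerivAt_comp hf s).continuousAt) a
  obtain ⟨B, hB, hB0, hBc⟩ := exists_coercive_primitive (hy.strictMono hg hg0)
    (continuous_iff_continuousAt.2 fun s => (hy.hasDerivAt_comp hg s).continuousAt) b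
  simp only [ha] at hA
  simp only [hb] at hB
  obtain ⟨C, hC⟩ := planar_bounded (τ := τ) (σ := σ) (v := nashV U)
    (fun t ht => by rw [← hφσ t ht]; exact hτ t ht)
    (fun t ht => by rw [← hθτ t ht]; exact hσ t ht) hA hB hA0 hB0 hAc hBc
  refine ⟨?_, ?_, ?_⟩
  · refine tendsto_average_of_bounded_primitive (b := fun t => σ t / nashV U)
      (C := C / |nashV U|) hfθ (fun t ht => ?_) (fun t ht => ?_)
    · exact ((hσ t ht).div_const (nashV U)).congr_deriv (by field_simp)
    · rw [abs_div]
      gcongr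
      exact (hC t ht).2.1
  · refine tendsto_average_of_bounded_primitive (b := fun t => -A (τ t)) (C := C) ?_
      (fun t ht => ?_) (fun t ht => ?_)
    · simp only [payoff, bilinearPayoff_mixed U hv (f _)]
      exact ((continuousOn_const.mul (hfθ.sub continuousOn_const)).mul
        (hgφ.sub continuousOn_const)).add continuousOn_const
    · refine ((hA (τ t)).comp_hasDerivWithinAt t (hτ t ht)).neg.congr_deriv ?_
      rw [payoff, bilinearPayoff_mixed U hv (f _), ← hθτ t ht]
      ring
    · rw [abs_neg]
      exact (hC t ht).2.2
  · refine tendsto_average_of_bounded_primitive (b := fun t => -τ t / nashV U)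
      (C := C / |nashV U|) hgφ (fun t ht => ?_) (fun t ht => ?_)
    · exact ((hτ t ht).neg.div_const (nashV U)).congr_deriv (by field_simp)
    · rw [abs_div, abs_neg]
      gcongr
      exact (hC t ht).1
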